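/- **Theorem (liveness of Flexible MinBFT).** Consider $N$ replicas $0,\dots,N-1$, at most $f$ of which are faulty (Byzantine), where $N\ge 2f+1$, and a replicated service given by a deterministic state machine. Suppose that the correct replicas run the protocol Flexible MinBFT below, with commit quorums of size $f+1$, view change quorums of size $N-f$, and $q$ messages $\mathsf{ReqViewChange}$ needed to trigger a view change, where $f+1\le q\le N-f$. Suppose that timing is partially synchronous. Then every operation requested by a correct client eventually completes, that is, the client receives replies with one and the same result from $f+1$ distinct replicas. *Model.* Time is discrete. There are an unknown time $\mathrm{GST}$ and an unknown bound $\Delta$ such that whatever a correct node sends, or holds in its retransmission buffer, at time $t$ reaches each correct addressee by time $\max(t,\mathrm{GST})+\Delta$. Apart from this, messages may be delayed, reordered and duplicated. Local computation takes no time of its own. Faulty replicas and clients behave arbitrarily, but cannot forge signatures of correct replicas or clients. Each replica has a trusted component (USIG) that certifies messages with successive counter values; not even a faulty replica obtains certificates for two messages with the same counter value. A correct client signs its requests $(c,\mathit{id},\mathit{op})$, sends them to all replicas, uses increasing identifiers, and makes a new request only after the previous one has completed. *Protocol.* The primary of view $v$ is replica $v \bmod N$; all replicas start in view $0$. $\mathsf{Prepare}$,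 $\mathsf{Commit}$, $\mathsf{ViewChange}$ and $\mathsf{NewView}$ messages are USIG-certified. Those of a given replica are processed in the order of their counter values without gaps, and only if they are valid: they belong to the view in which their sender is (determined by its $\mathsf{ViewChange}$ messages), proposals come from the primary of that view, and what they refer to has been processed as well. Correct replicas retransmit to all replicas the messages they hold, both their own and those received from others, so that lagging replicas can catch up. 1. *Prepare.* In view $v$ (if $v>0$, after its $\mathsf{NewView}$), the primary certifies a $\mathsf{Prepare}$ for each request $m$ that it holds, unless the sequence proposed in the view already has a command of the same client with the same or a larger identifier. The counter value is the sequence number of $m$. 2. *Commit.* A replica in view $v$ certifies a $\mathsf{Commit}$ for every valid proposal of view $v$, that is, for its $\mathsf{NewView}$ (if $v>0$) and its $\mathsf{Prepare}$ messages. 3. *Execute.* Commits of $f+1$ replicas for a proposal form a commit certificate. A replica that holds certificates for a proposal of a view and for all earlier proposals of that view executes the proposed sequence of commands up to that point, as far as it has not done so. It skips a command if an earlier command of the sequence comes from the same client and has the same or a larger identifier. It replies to the client of each executed command with the result. 4. *Request a view change.* A replica in view $v$ sends $\mathsf{ReqViewChange}$ for view $v+1$ if it has been in view $v$ for time $\tau(v)$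 and, moreover, either has no valid $\mathsf{NewView}$ of view $v>0$, or has held for time $\tau(v)$ a request that its executed sequence does not cover (by a command of the same client with the same or a larger identifier). The timeouts satisfy $\tau(v)\to\infty$ as $v\to\infty$ and are otherwise arbitrary. 5. *Enter a view.* A replica in a view below $v'$ that holds $\mathsf{ReqViewChange}$ messages for $v'$ from $q$ replicas enters view $v'$ and certifies a $\mathsf{ViewChange}$ message with the log $O$ of all the messages it has certified so far. (Logs are not truncated: the last stable checkpoint is the initial state.) 6. *New view.* The primary of view $v>0$, once in that view, certifies one $\mathsf{NewView}$ message with valid $\mathsf{ViewChange}$ messages for $v$ from at least $N-f$ replicas and a sequence $S$ of commands, which begins the proposed sequence of the view. $S$ is the sequence proposed up to the latest proposal (highest view, then highest counter value) that some of the logs $O$ show as prepared by its primary or committed; it is empty if there is none. A correct replica takes every action that is enabled without delay. -/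

import Mathlib

open Filter

namespace FlexMinBFT

/-- A client command: the issuing client, the identifier the client gave it, and the operation. -/
structure Command (Client Op : Type*) where
  client : Client
  id : ℕ
  op : Op

/-- The replicated service: a deterministic state machine. -/
structure Service (Op Res St : Type*) where
  start : St
  apply : St → Op → St × Res

/-- Bodies of the messages that carry a certificate of the trusted component (USIG).  Sender and
counter value are part of the certificate, see `Msg.certified`.
* `prepare v m`: the primary of view `v` proposes command `m`; its sequence number is the counter
  value of the certificate.
* `commit v k`: the sender accepts the proposal that the primary of view `v` certified with
  counter value `k`.
* `viewChange v O`: the sender moves to view `v`; `O` lists the messages it certified before.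
* `newView v V S`: the primary of view `v` opens it; `V` is the new view certificate, which lists
  the senders and the logs `O` of the `viewChange` messages used, and `S` is the sequence of
  prepared or committed commands computed from them. -/
inductive Body (N : ℕ) (Client Op : Type*) where
  | prepare (v : ℕ) (m : Command Client Op)
  | commit (v k : ℕ)
  | viewChange (v : ℕ) (O : List (Body N Client Op))
  | newView (v : ℕ) (V : List (Fin N × List (Body N Client Op))) (S : List (Command Client Op))

/-- Messages.  `certified r k b` is the body `b` with the certificate of the USIG of replica `r`
for counter value `k`; counter values start at `0`.  The others are signed by their author. -/
inductive Msg (N : ℕ) (Client Op Res : Type*) where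
  | request (m : Command Client Op)
  | certified (r : Fin N) (k : ℕ) (b : Body N Client Op)
  | reqViewChange (r : Fin N) (v v' : ℕ)
  | reply (r : Fin N) (c : Client) (id : ℕ) (res : Res)

/-- The replica that signed a message (none for requests, which are signed by clients). -/
def Msg.author {N : ℕ} {Client Op Res : Type*} : Msg N Client Op Res → Option (Fin N)
  | .request _ => none
  | .certified r _ _ => some r
  | .reqViewChange r _ _ => some r
  | .reply r _ _ _ => some r

/-- The primary of view `v` is replica `v mod N`. -/
def primary (N : ℕ) [NeZero N] (v : ℕ) : Fin N := Fin.ofNat N v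

section Service

variable {Client Op Res St : Type*}

/-- `m.id ≤ V_req[m.client]` for a replica that has gone through the sequence `h`: the sequence
has a command of the same client with the same or a larger identifier. -/
def Stale (h : List (Command Client Op)) (m : Command Client Op) : Prop :=
  ∃ m' ∈ h, m'.client = m.client ∧ m.id ≤ m'.id

open Classical in
/-- Service state after executing the commands `h'`, coming after `h`, from state `x`; stale
commands are skipped. -/
noncomputable def runFrom (svc : Service Op Res St) :
    List (Command Client Op) → St → List (Command Client Op) → St
  | _, x, [] => x
  | h, x, m :: h' =>
      runFrom svc (h ++ [m]) (if Stale h m then x else (svc.apply x m.op).1) h'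

/-- Service state after executing the sequence `h`. -/
noncomputable def run (svc : Service Op Res St) (h : List (Command Client Op)) : St :=
  runFrom svc [] svc.start h

/-- Along the sequence `h` the command `m` is executed (not skipped), with result `res`. -/
def Executes (svc : Service Op Res St) (h : List (Command Client Op)) (m : Command Client Op)
    (res : Res) : Prop :=
  ∃ h₁ h₂, h = h₁ ++ m :: h₂ ∧ ¬ Stale h₁ m ∧ res = (svc.apply (run svc h₁) m.op).2

end Service

section Messages

variable {N : ℕ} {Client Op : Type*}

/-- The view in which a replica is after certifying the messages `l`. -/
def curView (l : List (Body N Client Op)) : ℕ :=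
  l.foldl (fun w b => match b with | .viewChange v _ => v | _ => w) 0

/-- The sequence of commands proposed for view `v` by a primary that certified the messages `l`:
the sequence of its `newView` message, followed by the commands it prepared. -/
def histOf (v : ℕ) (l : List (Body N Client Op)) : List (Command Client Op) :=
  l.foldl (fun h b => match b with
    | .newView v' _ S => if v' = v then S else h
    | .prepare v' m => if v' = v then h ++ [m] else h
    | _ => h) []

/-- The messages by which a primary proposes (an extension of) the sequence of view `v`. -/
def IsProposal (v : ℕ) (b : Body N Client Op) : Prop :=
  (∃ m, b = .prepare v m) ∨ ∃ V S, b = .newView v V S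

/-- The log `O` shows that its owner prepared (as the primary) or committed the proposal of
view `w` with counter value `k`. -/
def Vouches (O : List (Body N Client Op)) (w k : ℕ) : Prop :=
  Body.commit w k ∈ O ∨ ∃ b, O[k]? = some b ∧ IsProposal w b

end Messages

section Protocol

variable {N : ℕ} [NeZero N] {Client Op Res St : Type*}

/-- `Accepted f K r l`: a replica that holds the messages `K` has processed and found valid the
messages `l`, which are the first ones certified by the USIG of `r`.  Messages of `r` are
processed strictly in the order of their counter values.

A `newView` needs `viewChange` messages from `N - f` replicas.  Its sequence `S` is the one
proposed up to the latest proposal (highest view, then highest counter value) that some log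
in these messages shows as prepared or committed, and empty if the logs show none. -/
inductive Accepted (f : ℕ) (K : Set (Msg N Client Op Res)) :
    Fin N → List (Body N Client Op) → Prop where
  | nil (r : Fin N) : Accepted f K r []
  | prepare {r : Fin N} {l : List (Body N Client Op)} {v : ℕ} {m : Command Client Op} :
      Accepted f K r l →
      .certified r l.length (.prepare v m) ∈ K →
      .request m ∈ K →
      r = primary N v → curView l = v →
      (v = 0 ∨ ∃ V S, Body.newView v V S ∈ l) →
      Accepted f K r (l ++ [.prepare v m])
  | commit {r : Fin N} {l l' : List (Body N Client Op)} {b : Body N Client Op} {v k : ℕ} :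
      Accepted f K r l →
      .certified r l.length (.commit v k) ∈ K →
      curView l = v →
      Accepted f K (primary N v) (l' ++ [b]) → l'.length = k → IsProposal v b →
      Accepted f K r (l ++ [.commit v k])
  | viewChange {r : Fin N} {l : List (Body N Client Op)} {v : ℕ} :
      Accepted f K r l →
      .certified r l.length (.viewChange v l) ∈ K →
      curView l < v →
      Accepted f K r (l ++ [.viewChange v l])
  | newViewEmpty {r : Fin N} {l : List (Body N Client Op)} {v : ℕ}
      {V : List (Fin N × List (Body N Client Op))} :
      Accepted f K r l →
      .certified r l.length (.newView v V []) ∈ K →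
      r = primary N v → curView l = v → (¬ ∃ V' S', Body.newView v V' S' ∈ l) →
      N ≤ V.length + f → (V.map Prod.fst).Nodup →
      (∀ e ∈ V, Accepted f K e.1 (e.2 ++ [.viewChange v e.2])) →
      (∀ e ∈ V, ∀ w k, ¬ Vouches e.2 w k) →
      Accepted f K r (l ++ [.newView v V []])
  | newView {r : Fin N} {l l' : List (Body N Client Op)} {v w k : ℕ}
      {V : List (Fin N × List (Body N Client Op))} :
      Accepted f K r l →
      .certified r l.length (.newView v V (histOf w l')) ∈ K →
      r = primary N v → curView l = v → (¬ ∃ V' S', Body.newView v V' S' ∈ l) →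
      N ≤ V.length + f → (V.map Prod.fst).Nodup →
      (∀ e ∈ V, Accepted f K e.1 (e.2 ++ [.viewChange v e.2])) →
      (∃ e ∈ V, Vouches e.2 w k) →
      (∀ e ∈ V, ∀ w' k', Vouches e.2 w' k' → w' < w ∨ (w' = w ∧ k' ≤ k)) →
      Accepted f K (primary N w) l' → l'.length = k + 1 →
      Accepted f K r (l ++ [.newView v V (histOf w l')])

/-- A commit certificate: accepted `commit` messages of `f + 1` replicas for the proposal with
counter value `k` of view `v`. -/
def Certificate (f : ℕ) (K : Set (Msg N Client Op Res)) (v k : ℕ) : Prop :=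
  ∃ Q : Finset (Fin N), f + 1 ≤ Q.card ∧ ∀ r ∈ Q, ∃ l, Accepted f K r (l ++ [.commit v k])

/-- `h` is the sequence proposed in some view up to some proposal, and that proposal and all
earlier ones of the view have commit certificates. -/
def Decided (f : ℕ) (K : Set (Msg N Client Op Res)) (h : List (Command Client Op)) : Prop :=
  ∃ v l b, Accepted f K (primary N v) (l ++ [b]) ∧ IsProposal v b ∧
    (∀ k b', (l ++ [b])[k]? = some b' → IsProposal v b' → Certificate f K v k) ∧
    h = histOf v (l ++ [b])

/-- State of a replica: the messages it holds (received or generated) with the tick at which it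
obtained them, the messages certified by its own USIG, its view, the tick at which it entered
this view, and the sequence of commands it has gone through in execution. -/
structure Replica (N : ℕ) (Client Op Res : Type*) where
  held : List (ℕ × Msg N Client Op Res)
  own : List (Body N Client Op)
  view : ℕ
  since : ℕ
  hist : List (Command Client Op)

namespace Replica

def initial : Replica N Client Op Res := ⟨[], [], 0, 0, []⟩

def msgs (s : Replica N Client Op Res) : Set (Msg N Client Op Res) :=
  {x | ∃ t, (t, x) ∈ s.held}

def hold (s : Replica N Client Op Res) (t : ℕ) (x : Msg N Client Op Res) :
    Replica N Client Op Res :=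
  { s with held := s.held ++ [(t, x)] }

def receive (s : Replica N Client Op Res) (t : ℕ) (inbox : List (Msg N Client Op Res)) :
    Replica N Client Op Res :=
  { s with held := s.held ++ inbox.map (fun x => (t, x)) }

/-- Replica `i` obtains a certificate for `b`, with its next counter value, from its USIG. -/
def issue (s : Replica N Client Op Res) (i : Fin N) (t : ℕ) (b : Body N Client Op) :
    Replica N Client Op Res :=
  { s.hold t (.certified i s.own.length b) with own := s.own ++ [b] }

/-- Replica `i` itself would accept `b` as its next certified message. -/
def MayIssue (f : ℕ) (s : Replica N Client Op Res) (i : Fin N) (b : Body N Client Op) : Prop :=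
  Accepted f (insert (.certified i s.own.length b) s.msgs) i (s.own ++ [b])

/-- The replica takes part in its current view: it is view `0`, or a valid `newView` arrived. -/
def Active (f : ℕ) (s : Replica N Client Op Res) : Prop :=
  s.view = 0 ∨
    ∃ l V S, Accepted f s.msgs (primary N s.view) l ∧ Body.newView s.view V S ∈ l

end Replica

/-- Parameters: `f` is the number of tolerated faults, `q` the number of `reqViewChange` messages
that trigger a view change, and `timeout v` the length of the timers in view `v`. -/
structure Params where
  f : ℕ
  q : ℕ
  timeout : ℕ → ℕ

/-- The actions of a correct replica `i` at tick `t`. -/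
inductive Act (P : Params) (svc : Service Op Res St) (i : Fin N) (t : ℕ) :
    Replica N Client Op Res → Replica N Client Op Res → Prop where
  /-- The primary proposes a requested command. -/
  | prepare (s : Replica N Client Op Res) (m : Command Client Op) :
      .request m ∈ s.msgs → ¬ Stale (histOf s.view s.own) m →
      s.MayIssue P.f i (.prepare s.view m) →
      Act P svc i t s (s.issue i t (.prepare s.view m))
  /-- A replica votes for a proposal of its current view. -/
  | commit (s : Replica N Client Op Res) (k : ℕ) :
      Body.commit s.view k ∉ s.own →
      s.MayIssue P.f i (.commit s.view k) →
      Act P svc i t s (s.issue i t (.commit s.view k))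
  /-- A replica executes commands once they have commit certificates. -/
  | execute (s : Replica N Client Op Res) (h : List (Command Client Op)) :
      Decided P.f s.msgs h → s.hist <+: h → s.hist ≠ h →
      Act P svc i t s { s with hist := h }
  /-- A replica replies to the client of an executed command. -/
  | reply (s : Replica N Client Op Res) (m : Command Client Op) (res : Res) :
      Executes svc s.hist m res →
      .reply i m.client m.id res ∉ s.msgs →
      Act P svc i t s (s.hold t (.reply i m.client m.id res))
  /-- A timer expires: the view has not been opened in time, or a request has been known for too
  long without being executed. -/
  | timeout (s : Replica N Client Op Res) :
      s.since + P.timeout s.view ≤ t →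
      (¬ s.Active P.f ∨ ∃ t₀ m, (t₀, Msg.request m) ∈ s.held ∧
        t₀ + P.timeout s.view ≤ t ∧ ¬ Stale s.hist m) →
      .reqViewChange i s.view (s.view + 1) ∉ s.msgs →
      Act P svc i t s (s.hold t (.reqViewChange i s.view (s.view + 1)))
  /-- `q` replicas request view `v`: the replica moves to it and says so. -/
  | enterView (s : Replica N Client Op Res) (v : ℕ) (Q : Finset (Fin N)) :
      s.view < v → P.q ≤ Q.card →
      (∀ r ∈ Q, ∃ w, .reqViewChange r w v ∈ s.msgs) →
      Act P svc i t s { s.issue i t (.viewChange v s.own) with view := v, since := t }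
  /-- The primary opens its view. -/
  | newView (s : Replica N Client Op Res) (V : List (Fin N × List (Body N Client Op)))
      (S : List (Command Client Op)) :
      s.MayIssue P.f i (.newView s.view V S) →
      Act P svc i t s (s.issue i t (.newView s.view V S))

/-- Tick `t` of a correct replica: it receives its inbox and acts until nothing is left to do. -/
def Tick (P : Params) (svc : Service Op Res St) (i : Fin N) (t : ℕ)
    (inbox : List (Msg N Client Op Res)) (s s' : Replica N Client Op Res) : Prop :=
  Relation.ReflTransGen (Act P svc i t) (s.receive t inbox) s' ∧ ∀ s'', ¬ Act P svc i t s' s''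

end Protocol

section Execution

variable {N : ℕ} [NeZero N] {Client Op Res St : Type*}

/-- What happens in a run.  `replica t i` is the state of replica `i` before tick `t`,
`inbox t i` and `clientInbox t c` the messages that arrive at tick `t`, and `submits t m` says
that the client of `m` requests `m` at tick `t`.  The states of faulty replicas are
irrelevant. -/
structure Execution (N : ℕ) (Client Op Res : Type*) where
  replica : ℕ → Fin N → Replica N Client Op Res
  inbox : ℕ → Fin N → List (Msg N Client Op Res)
  clientInbox : ℕ → Client → List (Msg N Client Op Res)
  submits : ℕ → Command Client Op → Prop

/-- By tick `t` the client of `m` has received replies with the same result from `f + 1`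
replicas. -/
def Completed (f : ℕ) (X : Execution N Client Op Res) (m : Command Client Op) (t : ℕ) : Prop :=
  ∃ res, ∃ Q : Finset (Fin N), f + 1 ≤ Q.card ∧
    ∀ r ∈ Q, ∃ t' ≤ t, .reply r m.client m.id res ∈ X.clientInbox t' m.client

def CorrectReplica (P : Params) (svc : Service Op Res St) (X : Execution N Client Op Res)
    (i : Fin N) : Prop :=
  X.replica 0 i = Replica.initial ∧
    ∀ t, Tick P svc i t (X.inbox t i) (X.replica t i) (X.replica (t + 1) i)

/-- A correct client uses increasing identifiers, and requests one operation at a time. -/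
def CorrectClient (f : ℕ) (X : Execution N Client Op Res) (c : Client) : Prop :=
  ∀ t t' m m', m.client = c → m'.client = c → X.submits t m → X.submits t' m' →
    (t = t' → m = m') ∧ (t < t' → m.id < m'.id ∧ Completed f X m t')

/-- The cryptographic assumptions, for the correct replicas `R` and the correct clients `C`:
nobody forges a signature of a correct replica or client, and no USIG, be it the one of a faulty
replica, certifies two messages with the same counter value. -/
structure Authentic (X : Execution N Client Op Res) (R : Finset (Fin N)) (C : Set Client) :
    Prop where
  replica : ∀ t, ∀ j ∈ R, ∀ x ∈ X.inbox t j, ∀ i ∈ R, x.author = some i →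
    x ∈ (X.replica t i).msgs
  reply : ∀ t, ∀ c ∈ C, ∀ x ∈ X.clientInbox t c, ∀ i ∈ R, x.author = some i →
    x ∈ (X.replica t i).msgs
  client : ∀ t, ∀ j ∈ R, ∀ m, .request m ∈ X.inbox t j → m.client ∈ C →
    ∃ t' ≤ t, X.submits t' m
  usig : ∀ t t', ∀ j ∈ R, ∀ j' ∈ R, ∀ r k b b', .certified r k b ∈ X.inbox t j →
    .certified r k b' ∈ X.inbox t' j' → b = b'

/-- Partial synchrony: from some time on, communication between correct nodes takes a bounded
time; neither that time nor the bound is known to the protocol.  Messages may be lost, reordered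
and duplicated, but correct nodes keep what they sent or forward in a buffer and retransmit it,
so that eventually it arrives.  Replicas retransmit all the messages that they hold. -/
def PartiallySynchronous (X : Execution N Client Op Res) (R : Finset (Fin N)) (C : Set Client) :
    Prop :=
  ∃ GST Δ : ℕ,
    (∀ t, ∀ i ∈ R, ∀ x ∈ (X.replica t i).msgs, ∀ j ∈ R,
      ∃ t' ≤ max t GST + Δ, x ∈ X.inbox t' j) ∧
    (∀ t, ∀ i ∈ R, ∀ r, ∀ c ∈ C, ∀ id res, .reply r c id res ∈ (X.replica t i).msgs →
      ∃ t' ≤ max t GST + Δ, .reply r c id res ∈ X.clientInbox t' c) ∧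
    (∀ t m, m.client ∈ C → X.submits t m → ∀ j ∈ R,
      ∃ t' ≤ max t GST + Δ, .request m ∈ X.inbox t' j)

end Execution

end FlexMinBFT

namespace FlexMinBFT

set_option linter.unusedSectionVars false

/-! ### Message logs: current view, proposed sequence, latest vouched proposal -/

section Logs

variable {N : ℕ} {Client Op : Type*}

/-! Suppose that a request `m` of a correct client never completes. The client then makes no later
request, so the only command that can cover `m` is `m` itself.

Safety keeps execution from getting stuck. USIG counters make any two accepted logs of one replica
comparable, and a `viewChange` must list everything certified before it, so even a faulty replica
cannot hide an earlier commit. A commit certificate (f + 1 replicas) and a new view certificate (N -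
f) share a sender. By induction on the view, every later view extends the certified sequence
(`Certificate.histOf_prefix`). Hence decided sequences are comparable (`Decided.prefix_or_prefix`),
and a correct replica can always execute what its messages decide (`Faithful.prefix_hist`).

Progress is a race between timeouts and message delays. While `m` is not executed, the timers of the
at least N - f ≥ q correct replicas drive them to arbitrarily high views
(`Faithful.exists_le_view`). Since q ≥ f + 1, leaving a view needs the request of a correct replica,
so no correct replica passes view v until τ(v) has elapsed since all of them were below v
(`Faithful.view_le`). Take v with a correct primary and τ(v) longer than four delays. One delay
gathers all correct replicas in v; the other three carry the view changes, the proposals and the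
commits (`Faithful.mem_hist_of_stable`). So `m` is executed after all. The decision spreads, and by
determinism all correct replicas, at least f + 1, reply with the same result (`Faithful.completed`).
-/

@[simp] theorem curView_append_prepare (l : List (Body N Client Op)) (v : ℕ)
    (m : Command Client Op) : curView (l ++ [.prepare v m]) = curView l := by
  simp [curView]

@[simp] theorem curView_append_commit (l : List (Body N Client Op)) (v k : ℕ) :
    curView (l ++ [.commit v k]) = curView l := by
  simp [curView]

@[simp] theorem curView_append_viewChange (l : List (Body N Client Op)) (v : ℕ)
    (O : List (Body N Client Op)) : curView (l ++ [.viewChange v O]) = v := by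
  simp [curView]

@[simp] theorem curView_append_newView (l : List (Body N Client Op)) (v : ℕ)
    (V : List (Fin N × List (Body N Client Op))) (S : List (Command Client Op)) :
    curView (l ++ [.newView v V S]) = curView l := by
  simp [curView]

@[simp] theorem histOf_nil (v : ℕ) : histOf v ([] : List (Body N Client Op)) = [] := rfl

theorem histOf_append_prepare (v : ℕ) (l : List (Body N Client Op)) (w : ℕ)
    (m : Command Client Op) :
    histOf v (l ++ [.prepare w m]) = if w = v then histOf v l ++ [m] else histOf v l := by
  simp [histOf]

theorem histOf_append_newView (v : ℕ) (l : List (Body N Client Op)) (w : ℕ)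
    (V : List (Fin N × List (Body N Client Op))) (S : List (Command Client Op)) :
    histOf v (l ++ [.newView w V S]) = if w = v then S else histOf v l := by
  simp [histOf]

theorem histOf_append_of_not_isProposal {v : ℕ} (l : List (Body N Client Op))
    {b : Body N Client Op} (hb : ¬ IsProposal v b) : histOf v (l ++ [b]) = histOf v l := by
  cases b with
  | prepare w m =>
    rw [histOf_append_prepare, if_neg]
    rintro rfl
    exact hb (.inl ⟨m, rfl⟩)
  | newView w V S =>
    rw [histOf_append_newView, if_neg]
    rintro rfl
    exact hb (.inr ⟨V, S, rfl⟩)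
  | commit w k => simp [histOf]
  | viewChange w O => simp [histOf]

/-- A log that proposes in view `v` has a last proposal, which determines the sequence. -/
theorem exists_last_proposal {v : ℕ} (l : List (Body N Client Op))
    (h : ∃ b ∈ l, IsProposal v b) :
    ∃ l' b, l' ++ [b] <+: l ∧ IsProposal v b ∧ histOf v (l' ++ [b]) = histOf v l := by
  induction l using List.reverseRecOn with
  | nil => simp at h
  | append_singleton l b ih =>
    by_cases hb : IsProposal v b
    · exact ⟨l, b, List.prefix_rfl, hb, rfl⟩
    · obtain ⟨l', b', h₁, h₂, h₃⟩ := ih (by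
        obtain ⟨b', hb', hp⟩ := h
        rcases List.mem_append.1 hb' with hl | hl
        · exact ⟨b', hl, hp⟩
        · rw [List.mem_singleton.1 hl] at hp
          exact absurd hp hb)
      exact ⟨l', b', h₁.trans (List.prefix_append _ _), h₂,
        h₃.trans (histOf_append_of_not_isProposal l hb).symm⟩

theorem take_succ_eq_append {α : Type*} {l : List α} {k : ℕ} {b : α} (h : l[k]? = some b) :
    l.take (k + 1) = l.take k ++ [b] := by
  rw [List.take_add_one, h]
  rfl

/-- The view to which a message body refers. -/
def Body.view : Body N Client Op → ℕ
  | .prepare v _ => v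
  | .commit v _ => v
  | .viewChange v _ => v
  | .newView v _ _ => v

theorem finite_vouches (O : List (Body N Client Op)) :
    {p : ℕ × ℕ | Vouches O p.1 p.2}.Finite := by
  have h₁ : {p : ℕ × ℕ | Body.commit p.1 p.2 ∈ O}.Finite := by
    refine Set.Finite.preimage (f := fun p : ℕ × ℕ => (Body.commit p.1 p.2 : Body N Client Op))
      (fun p _ p' _ h => ?_) (List.finite_toSet O)
    injection h with h h'
    exact Prod.ext h h'
  have h₂ : {p : ℕ × ℕ | ∃ b, O[p.2]? = some b ∧ IsProposal p.1 b}.Finite := by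
    -- The counter value determines the view, which is read off from the log entry; the default 0 is
    -- never used, since the index is below the length.
    refine ((Set.finite_lt_nat O.length).image
      (fun k => (((O[k]?).map Body.view).getD 0, k))).subset ?_
    rintro ⟨w, k⟩ ⟨b, hb, hp⟩
    refine ⟨k, (List.getElem?_eq_some_iff.1 hb).1, ?_⟩
    simp only at hb hp
    rcases hp with ⟨m, rfl⟩ | ⟨V, S, rfl⟩ <;> simp [hb, Body.view]
  exact h₁.union h₂

/-- Among finitely many logs that vouch for some proposal there is a latest one. -/
theorem exists_latest_vouched {V : List (Fin N × List (Body N Client Op))}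
    (h : ∃ e ∈ V, ∃ w k, Vouches e.2 w k) :
    ∃ w k, (∃ e ∈ V, Vouches e.2 w k) ∧
      ∀ e ∈ V, ∀ w' k', Vouches e.2 w' k' → w' < w ∨ (w' = w ∧ k' ≤ k) := by
  have hfin : {p : ℕ × ℕ | ∃ e ∈ V, Vouches e.2 p.1 p.2}.Finite := by
    have := Set.Finite.biUnion (List.finite_toSet V)
      (fun (e : Fin N × List (Body N Client Op)) (_ : e ∈ {e | e ∈ V}) => finite_vouches e.2)
    refine this.subset ?_
    rintro p ⟨e, he, hp⟩
    exact Set.mem_biUnion (show e ∈ {e | e ∈ V} from he) hp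
  obtain ⟨e, he, w, k, hwk⟩ := h
  obtain ⟨p, hp, hmax⟩ := Set.exists_max_image _ toLex hfin ⟨(w, k), e, he, hwk⟩
  refine ⟨p.1, p.2, hp, fun e' he' w' k' h' => ?_⟩
  exact Prod.Lex.toLex_le_toLex.1 (hmax (w', k') ⟨e', he', h'⟩)

/-- Quorum intersection: (N - f) + (f + 1) > N. The common sender may be faulty. -/
theorem exists_common_sender {f : ℕ} {V : List (Fin N × List (Body N Client Op))} {Q : Finset (Fin N)}
    (hV : N ≤ V.length + f) (hV' : (V.map Prod.fst).Nodup) (hQ : f + 1 ≤ Q.card) :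
    ∃ e ∈ V, e.1 ∈ Q := by
  have hcard : (V.map Prod.fst).toFinset.card = V.length := by
    rw [List.toFinset_card_of_nodup hV', List.length_map]
  by_contra! hne
  have hd : Disjoint (V.map Prod.fst).toFinset Q := by
    rw [Finset.disjoint_left]
    intro r hr
    obtain ⟨e, he, rfl⟩ := List.mem_map.1 (List.mem_toFinset.1 hr)
    exact hne e he
  have := Finset.card_le_univ ((V.map Prod.fst).toFinset ∪ Q)
  rw [Finset.card_union_of_disjoint hd, hcard, Fintype.card_fin] at this
  omega

end Logs

/-! ### Accepted logs and safety -/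

section Accepted

variable {N : ℕ} [NeZero N] {Client Op Res St : Type*} {f : ℕ} {K K' : Set (Msg N Client Op Res)}
  {r : Fin N} {l l' : List (Body N Client Op)} {b b' : Body N Client Op}

theorem Accepted.mono (hK : K ⊆ K') (h : Accepted f K r l) : Accepted f K' r l := by
  induction h with
  | nil r => exact .nil r
  | prepare _ h₁ h₂ h₃ h₄ h₅ ih => exact .prepare ih (hK h₁) (hK h₂) h₃ h₄ h₅
  | commit _ h₁ h₂ _ h₃ h₄ ih ih' => exact .commit ih (hK h₁) h₂ ih' h₃ h₄
  | viewChange _ h₁ h₂ ih => exact .viewChange ih (hK h₁) h₂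
  | newViewEmpty _ h₁ h₂ h₃ h₄ h₅ h₆ _ h₇ ih ih' =>
    exact .newViewEmpty ih (hK h₁) h₂ h₃ h₄ h₅ h₆ ih' h₇
  | newView _ h₁ h₂ h₃ h₄ h₅ h₆ _ h₇ h₈ _ h₉ ih ih' ih'' =>
    exact .newView ih (hK h₁) h₂ h₃ h₄ h₅ h₆ ih' h₇ h₈ ih'' h₉

/-- What makes `b` a valid message of `r` after the messages `l`. -/
def Valid (f : ℕ) (K : Set (Msg N Client Op Res)) (r : Fin N) (l : List (Body N Client Op)) :
    Body N Client Op → Prop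
  | .prepare v m => .request m ∈ K ∧ r = primary N v ∧ curView l = v ∧
      (v = 0 ∨ ∃ V S, Body.newView v V S ∈ l)
  | .commit v k => curView l = v ∧ ∃ l' b, Accepted f K (primary N v) (l' ++ [b]) ∧
      l'.length = k ∧ IsProposal v b
  | .viewChange v O => O = l ∧ curView l < v
  | .newView v V S => r = primary N v ∧ curView l = v ∧ (¬ ∃ V' S', Body.newView v V' S' ∈ l) ∧
      N ≤ V.length + f ∧ (V.map Prod.fst).Nodup ∧
      (∀ e ∈ V, Accepted f K e.1 (e.2 ++ [.viewChange v e.2])) ∧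
      ((S = [] ∧ ∀ e ∈ V, ∀ w k, ¬ Vouches e.2 w k) ∨
        ∃ w k l', S = histOf w l' ∧ (∃ e ∈ V, Vouches e.2 w k) ∧
          (∀ e ∈ V, ∀ w' k', Vouches e.2 w' k' → w' < w ∨ (w' = w ∧ k' ≤ k)) ∧
          Accepted f K (primary N w) l' ∧ l'.length = k + 1)

/-- Inverts the last step of a derivation, so that later proofs can induct on the log instead of on
the nested derivation. -/
theorem accepted_append_iff :
    Accepted f K r (l ++ [b]) ↔
      Accepted f K r l ∧ .certified r l.length b ∈ K ∧ Valid f K r l b := by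
  constructor
  · intro h
    generalize hL : l ++ [b] = L at h
    cases h with
    | nil r => simp at hL
    | prepare h₀ h₁ h₂ h₃ h₄ h₅ =>
      obtain ⟨rfl, h⟩ := List.append_inj' hL rfl
      obtain rfl := List.singleton_inj.1 h
      exact ⟨h₀, h₁, h₂, h₃, h₄, h₅⟩
    | commit h₀ h₁ h₂ h₃ h₄ h₅ =>
      obtain ⟨rfl, h⟩ := List.append_inj' hL rfl
      obtain rfl := List.singleton_inj.1 h
      exact ⟨h₀, h₁, h₂, _, _, h₃, h₄, h₅⟩
    | viewChange h₀ h₁ h₂ =>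
      obtain ⟨rfl, h⟩ := List.append_inj' hL rfl
      obtain rfl := List.singleton_inj.1 h
      exact ⟨h₀, h₁, rfl, h₂⟩
    | newViewEmpty h₀ h₁ h₂ h₃ h₄ h₅ h₆ h₇ h₈ =>
      obtain ⟨rfl, h⟩ := List.append_inj' hL rfl
      obtain rfl := List.singleton_inj.1 h
      exact ⟨h₀, h₁, h₂, h₃, h₄, h₅, h₆, h₇, .inl ⟨rfl, h₈⟩⟩
    | newView h₀ h₁ h₂ h₃ h₄ h₅ h₆ h₇ h₈ h₉ h₁₀ h₁₁ =>
      obtain ⟨rfl, h⟩ := List.append_inj' hL rfl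
      obtain rfl := List.singleton_inj.1 h
      exact ⟨h₀, h₁, h₂, h₃, h₄, h₅, h₆, h₇, .inr ⟨_, _, _, rfl, h₈, h₉, h₁₀, h₁₁⟩⟩
  · rintro ⟨h₀, h₁, h⟩
    cases b with
    | prepare v m =>
      obtain ⟨h₂, h₃, h₄, h₅⟩ := h
      exact .prepare h₀ h₁ h₂ h₃ h₄ h₅
    | commit v k =>
      obtain ⟨h₂, l', b, h₃, h₄, h₅⟩ := h
      exact .commit h₀ h₁ h₂ h₃ h₄ h₅
    | viewChange v O =>
      obtain ⟨rfl, h₂⟩ := h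
      exact .viewChange h₀ h₁ h₂
    | newView v V S =>
      obtain ⟨h₂, h₃, h₄, h₅, h₆, h₇, ⟨rfl, h₈⟩ | ⟨w, k, l', rfl, h₈, h₉, h₁₀, h₁₁⟩⟩ := h
      · exact .newViewEmpty h₀ h₁ h₂ h₃ h₄ h₅ h₆ h₇ h₈
      · exact .newView h₀ h₁ h₂ h₃ h₄ h₅ h₆ h₇ h₈ h₉ h₁₀ h₁₁

theorem Accepted.of_prefix (h : Accepted f K r l) (hl : l' <+: l) : Accepted f K r l' := by
  induction l using List.reverseRecOn with
  | nil => rwa [List.prefix_nil.1 hl]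
  | append_singleton l b ih =>
    rcases List.prefix_concat_iff.1 hl with rfl | hl
    · exact h
    · exact ih (accepted_append_iff.1 h).1 hl

theorem Accepted.take_append (h : Accepted f K r l) {k : ℕ} (hk : l[k]? = some b) :
    Accepted f K r (l.take k ++ [b]) :=
  h.of_prefix (take_succ_eq_append hk ▸ List.take_prefix _ _)

theorem Accepted.valid (h : Accepted f K r l) {k : ℕ} (hk : l[k]? = some b) :
    Valid f K r (l.take k) b :=
  (accepted_append_iff.1 (h.take_append hk)).2.2

theorem Accepted.certified_mem (h : Accepted f K r l) {k : ℕ} (hk : l[k]? = some b) :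
    .certified r k b ∈ K := by
  have := (accepted_append_iff.1 (h.take_append hk)).2.1
  rwa [List.length_take_of_le (List.getElem?_eq_some_iff.1 hk).1.le] at this

/-- No USIG certifies two messages with the same counter value. -/
def UniqueCertificates (K : Set (Msg N Client Op Res)) : Prop :=
  ∀ r k b b', .certified r k b ∈ K → .certified r k b' ∈ K → b = b'

/-- Here the trusted counter acts: each position of an accepted log is backed by a certificate with
that counter value, so equivocation is impossible. -/
theorem Accepted.prefix_of_length_le (hU : UniqueCertificates K) (h : Accepted f K r l)
    (h' : Accepted f K r l') (hl : l.length ≤ l'.length) : l <+: l' := by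
  rw [List.prefix_iff_getElem?]
  intro k hk
  have h₁ : l[k]? = some l[k] := List.getElem?_eq_getElem hk
  have h₂ : l'[k]? = some (l'[k]'(hk.trans_le hl)) := List.getElem?_eq_getElem _
  rw [h₂, hU _ _ _ _ (h.certified_mem h₁) (h'.certified_mem h₂)]

theorem Accepted.curView_le (h : Accepted f K r l) (hl : l' <+: l) : curView l' ≤ curView l := by
  induction l using List.reverseRecOn with
  | nil => rw [List.prefix_nil.1 hl]
  | append_singleton l b ih =>
    rcases List.prefix_concat_iff.1 hl with rfl | hl
    · exact le_rfl
    · obtain ⟨h₀, -, h₁⟩ := accepted_append_iff.1 h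
      refine (ih h₀ hl).trans ?_
      cases b with
      | prepare v m => simp
      | commit v k => simp
      | newView v V S => simp
      | viewChange v O => simpa using h₁.2.le

theorem Accepted.proposal (h : Accepted f K r l) {k v : ℕ} (hk : l[k]? = some b)
    (hb : IsProposal v b) : r = primary N v ∧ curView (l.take k) = v := by
  have := h.valid hk
  rcases hb with ⟨m, rfl⟩ | ⟨V, S, rfl⟩
  · exact ⟨this.2.1, this.2.2.1⟩
  · exact ⟨this.1, this.2.1⟩

/-- As f < N, the new view certificate is nonempty, and any `viewChange` in it moves strictly
upwards to `v`. -/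
theorem Valid.view_pos (hf : f < N) {v : ℕ} {V : List (Fin N × List (Body N Client Op))}
    {S : List (Command Client Op)} (h : Valid f K r l (.newView v V S)) : 0 < v := by
  obtain ⟨-, -, -, h₁, -, h₂, -⟩ := h
  cases V with
  | nil => simp at h₁; omega
  | cons e V => exact (Nat.zero_le _).trans_lt (accepted_append_iff.1 (h₂ e (by simp))).2.2.2

theorem Accepted.newView_mem (h : Accepted f K r l) {v : ℕ} (hv : 0 < v) (hb : b ∈ l)
    (hp : IsProposal v b) : ∃ V S, Body.newView v V S ∈ l := by
  obtain ⟨k, hk⟩ := List.mem_iff_getElem?.1 hb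
  rcases hp with ⟨m, rfl⟩ | ⟨V, S, rfl⟩
  · rcases (h.valid hk).2.2.2 with rfl | ⟨V, S, hV⟩
    · exact absurd hv (lt_irrefl _)
    · exact ⟨V, S, List.mem_of_mem_take hV⟩
  · exact ⟨V, S, hb⟩

/-- Once a view is opened, its sequence only grows. -/
theorem Accepted.histOf_prefix (hf : f < N) (h : Accepted f K r l) {v : ℕ} (hl : l' <+: l)
    (hb : ∃ b ∈ l', IsProposal v b) : histOf v l' <+: histOf v l := by
  induction l using List.reverseRecOn with
  | nil => rw [List.prefix_nil.1 hl]
  | append_singleton l b ih =>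
    rcases List.prefix_concat_iff.1 hl with rfl | hl₀
    · exact List.prefix_rfl
    · obtain ⟨h₀, -, h₁⟩ := accepted_append_iff.1 h
      refine (ih h₀ hl₀).trans ?_
      by_cases hp : IsProposal v b
      · rcases hp with ⟨m, rfl⟩ | ⟨V, S, rfl⟩
        · simp [histOf_append_prepare]
        · obtain ⟨b, hb, hp⟩ := hb
          exact absurd (h₀.newView_mem (h₁.view_pos hf) (hl₀.subset hb) hp) h₁.2.2.1
      · rw [histOf_append_of_not_isProposal l hp]

/-- Even a faulty primary can only propose commands whose signed request is held; this brings the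
discipline of correct clients to bear on proposed sequences. -/
theorem Accepted.request_mem (h : Accepted f K r l) {v : ℕ} {m : Command Client Op}
    (hm : m ∈ histOf v l) : .request m ∈ K := by
  induction h generalizing v m with
  | nil r => simp at hm
  | prepare _ _ h₂ _ _ _ ih =>
    rw [histOf_append_prepare] at hm
    split_ifs at hm
    · rcases List.mem_append.1 hm with hm | hm
      · exact ih hm
      · rwa [List.mem_singleton.1 hm]
    · exact ih hm
  | commit _ _ _ _ _ _ ih => exact ih (by simpa [histOf] using hm)
  | viewChange _ _ _ ih => exact ih (by simpa [histOf] using hm)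
  | newViewEmpty _ _ _ _ _ _ _ _ _ ih =>
    rw [histOf_append_newView] at hm
    split_ifs at hm
    · simp at hm
    · exact ih hm
  | newView _ _ _ _ _ _ _ _ _ _ _ _ ih _ ih' =>
    rw [histOf_append_newView] at hm
    split_ifs at hm
    · exact ih' hm
    · exact ih hm

theorem Accepted.of_vouches (h : Accepted f K r l) {w k : ℕ} (hV : Vouches l w k) :
    w ≤ curView l ∧ ∃ l' b, Accepted f K (primary N w) (l' ++ [b]) ∧ l'.length = k ∧
      IsProposal w b := by
  rcases hV with hc | ⟨b, hb, hp⟩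
  · obtain ⟨j, hj⟩ := List.mem_iff_getElem?.1 hc
    have := h.valid hj
    exact ⟨this.1 ▸ h.curView_le (List.take_prefix _ _), this.2⟩
  · obtain ⟨rfl, hw⟩ := h.proposal hb hp
    exact ⟨hw.symm.le.trans (h.curView_le (List.take_prefix _ _)), l.take k, b, h.take_append hb,
      List.length_take_of_le (List.getElem?_eq_some_iff.1 hb).1.le, hp⟩

/-- A view opened after a proposal got a commit certificate extends that proposal. -/
theorem Certificate.histOf_prefix (hU : UniqueCertificates K) (hf : f < N) {v : ℕ}
    (hl : Accepted f K (primary N v) (l ++ [b])) (hb : IsProposal v b)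
    (hc : Certificate f K v l.length) {w : ℕ} (hvw : v < w) (hl' : Accepted f K (primary N w) l')
    (hb' : ∃ b ∈ l', IsProposal w b) : histOf v (l ++ [b]) <+: histOf w l' := by
  induction w using Nat.strong_induction_on generalizing l' with
  | h w ih =>
    obtain ⟨b', hb', hp'⟩ := hb'
    obtain ⟨V, S, hVS⟩ := hl'.newView_mem (by omega) hb' hp'
    obtain ⟨j, hj⟩ := List.mem_iff_getElem?.1 hVS
    -- The sequence of view `w` starts with `S`, so it suffices to extend the certified sequence by
    -- `S`.
    have hpre : S <+: histOf w l' := by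
      have := hl'.histOf_prefix (v := w) hf (List.take_prefix (j + 1) l')
        ⟨.newView w V S, by rw [take_succ_eq_append hj]; simp, .inr ⟨V, S, rfl⟩⟩
      rwa [take_succ_eq_append hj, histOf_append_newView, if_pos rfl] at this
    refine List.IsPrefix.trans ?_ hpre
    obtain ⟨-, -, -, hN, hnd, hV, hS⟩ := hl'.valid hj
    obtain ⟨Q, hQ, hQc⟩ := hc
    obtain ⟨e, he, heQ⟩ := exists_common_sender hN hnd hQ
    obtain ⟨lc, hlc⟩ := hQc _ heQ
    -- The common sender committed before its `viewChange` to `w`: afterwards its view would be at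
    -- least `w > v`, where a commit for `v` is invalid. Logs being complete, the commit is in
    -- `e.2`.
    have hcom : Body.commit v l.length ∈ e.2 := by
      rcases le_or_gt (e.2 ++ [Body.viewChange w e.2]).length (lc ++ [Body.commit v l.length]).length
        with hle | hlt
      · have := hlc.curView_le ((hV e he).prefix_of_length_le hU hlc hle)
        have h' := (accepted_append_iff.1 hlc).2.2.1
        simp only [curView_append_viewChange, curView_append_commit] at this
        omega
      · refine (hlc.prefix_of_length_le hU (accepted_append_iff.1 (hV e he)).1 ?_).subset
          (by simp)
        simp only [List.length_append, List.length_singleton] at hlt ⊢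
        omega
    rcases hS with ⟨-, hS⟩ | ⟨x, k, l₂, rfl, ⟨e₂, he₂, hx⟩, hmax, hl₂, hlen⟩
    · exact absurd (.inl hcom) (hS e he _ _)
    have hxw : x < w :=
      ((accepted_append_iff.1 (hV e₂ he₂)).1.of_vouches hx).1.trans_lt
        (accepted_append_iff.1 (hV e₂ he₂)).2.2.2
    -- The latest vouched proposal is not earlier than the certified one. If its view is later, the
    -- induction hypothesis applies to that view; if the view is the same, the counter values are
    -- ordered and the sequence only grows.
    rcases hmax e he _ _ (.inl hcom) with hvx | ⟨rfl, hk⟩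
    · obtain ⟨-, l₃, b₃, hl₃, rfl, hb₃⟩ := (accepted_append_iff.1 (hV e₂ he₂)).1.of_vouches hx
      refine ih x hxw hvx hl₂ ⟨b₃, ?_, hb₃⟩
      exact (hl₃.prefix_of_length_le hU hl₂ (by simp [hlen])).subset (by simp)
    · exact hl₂.histOf_prefix hf (hl.prefix_of_length_le hU hl₂ (by simp [hlen, hk]))
        ⟨b, by simp, hb⟩

theorem Certificate.mono (hK : K ⊆ K') {v k : ℕ} (h : Certificate f K v k) :
    Certificate f K' v k := by
  obtain ⟨Q, hQ, h⟩ := h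
  exact ⟨Q, hQ, fun r hr => (h r hr).imp fun _ hl => hl.mono hK⟩

theorem Decided.mono (hK : K ⊆ K') {h : List (Command Client Op)} (hd : Decided f K h) :
    Decided f K' h := by
  obtain ⟨v, l, b, h₁, h₂, h₃, h₄⟩ := hd
  exact ⟨v, l, b, h₁.mono hK, h₂, fun k b' hk hb' => (h₃ k b' hk hb').mono hK, h₄⟩

theorem Decided.request_mem {h : List (Command Client Op)} (hd : Decided f K h)
    {m : Command Client Op} (hm : m ∈ h) : .request m ∈ K := by
  obtain ⟨v, l, b, h₁, -, -, rfl⟩ := hd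
  exact h₁.request_mem hm

/-- Safety: decided sequences are consistent. -/
theorem Decided.prefix_or_prefix (hU : UniqueCertificates K) (hf : f < N)
    {h h' : List (Command Client Op)} (hd : Decided f K h) (hd' : Decided f K h') :
    h <+: h' ∨ h' <+: h := by
  obtain ⟨v, l, b, hl, hb, hc, rfl⟩ := hd
  obtain ⟨v', l', b', hl', hb', hc', rfl⟩ := hd'
  rcases lt_trichotomy v v' with hv | rfl | hv
  · exact .inl ((hc l.length b (by simp) hb).histOf_prefix hU hf hl hb hv hl'
      ⟨b', by simp, hb'⟩)
  · rcases le_total (l ++ [b]).length (l' ++ [b']).length with hle | hle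
    · exact .inl (hl'.histOf_prefix hf (hl.prefix_of_length_le hU hl' hle) ⟨b, by simp, hb⟩)
    · exact .inr (hl.histOf_prefix hf (hl'.prefix_of_length_le hU hl hle) ⟨b', by simp, hb'⟩)
  · exact .inr ((hc' l'.length b' (by simp) hb').histOf_prefix hU hf hl' hb' hv hl
      ⟨b, by simp, hb⟩)

end Accepted

/-! ### Replica states: monotonicity, invariants, and what inactivity implies -/

section States

variable {N : ℕ} [NeZero N] {Client Op Res St : Type*} {P : Params} {svc : Service Op Res St}
  {i : Fin N} {t : ℕ} {s s' : Replica N Client Op Res}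

namespace Replica

@[simp] theorem msgs_hold (s : Replica N Client Op Res) (t : ℕ) (x : Msg N Client Op Res) :
    (s.hold t x).msgs = insert x s.msgs := by
  ext y
  simp only [msgs, hold, List.mem_append, List.mem_singleton, Prod.mk.injEq, Set.mem_ofPred_eq,
    Set.mem_insert_iff, exists_or]
  tauto

@[simp] theorem msgs_issue (s : Replica N Client Op Res) (i : Fin N) (t : ℕ)
    (b : Body N Client Op) :
    (s.issue i t b).msgs = insert (.certified i s.own.length b) s.msgs :=
  msgs_hold s t _

theorem mem_msgs_receive {inbox : List (Msg N Client Op Res)} {x : Msg N Client Op Res} :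
    x ∈ (s.receive t inbox).msgs ↔ x ∈ s.msgs ∨ x ∈ inbox := by
  simp only [msgs, receive, List.mem_append, List.mem_map, Prod.mk.injEq, Set.mem_ofPred_eq,
    exists_or]
  refine or_congr_right ⟨?_, fun h => ⟨t, x, h, rfl, rfl⟩⟩
  rintro ⟨_, y, hy, -, rfl⟩
  exact hy

/-- `s'` is a possible later state of a replica in state `s`. -/
structure Le (s s' : Replica N Client Op Res) : Prop where
  held : s.held ⊆ s'.held
  hist : s.hist <+: s'.hist
  view : s.view ≤ s'.view
  since : s.view = s'.view → s.since = s'.since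

theorem Le.refl (s : Replica N Client Op Res) : s.Le s :=
  ⟨fun _ h => h, List.prefix_rfl, le_rfl, fun _ => rfl⟩

theorem Le.trans {s s' s'' : Replica N Client Op Res} (h : s.Le s') (h' : s'.Le s'') :
    s.Le s'' where
  held := fun _ hx => h'.held (h.held hx)
  hist := h.hist.trans h'.hist
  view := h.view.trans h'.view
  since := fun hv =>
    have h₁ : s.view = s'.view := le_antisymm h.view (hv ▸ h'.view)
    (h.since h₁).trans (h'.since (h₁.symm.trans hv))

theorem Le.msgs (h : s.Le s') : s.msgs ⊆ s'.msgs := fun _ ⟨t, hx⟩ => ⟨t, h.held hx⟩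

theorem le_receive (s : Replica N Client Op Res) (t : ℕ) (inbox : List (Msg N Client Op Res)) :
    s.Le (s.receive t inbox) :=
  ⟨List.subset_append_left _ _, List.prefix_rfl, le_rfl, fun _ => rfl⟩

theorem le_hold (s : Replica N Client Op Res) (t : ℕ) (x : Msg N Client Op Res) :
    s.Le (s.hold t x) :=
  ⟨List.subset_append_left _ _, List.prefix_rfl, le_rfl, fun _ => rfl⟩

theorem le_issue (s : Replica N Client Op Res) (i : Fin N) (t : ℕ) (b : Body N Client Op) :
    s.Le (s.issue i t b) :=
  ⟨List.subset_append_left _ _, List.prefix_rfl, le_rfl, fun _ => rfl⟩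

/-- What holds in every state `s` of the correct replica `i`. -/
structure Inv (P : Params) (i : Fin N) (s : Replica N Client Op Res) : Prop where
  certified : ∀ k b, .certified i k b ∈ s.msgs → s.own[k]? = some b
  own : Accepted P.f s.msgs i s.own
  view : curView s.own = s.view
  entered : s.view = 0 ∨
    (∃ Q : Finset (Fin N), P.q ≤ Q.card ∧ ∀ r ∈ Q, ∃ w, .reqViewChange r w s.view ∈ s.msgs) ∧
      ∃ O, O ++ [.viewChange s.view O] <+: s.own
  requested : ∀ w v, .reqViewChange i w v ∈ s.msgs → v ≤ s.view + 1
  hist : s.hist = [] ∨ Decided P.f s.msgs s.hist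

theorem inv_initial : (initial : Replica N Client Op Res).Inv P i where
  certified := by simp [msgs, initial]
  own := .nil i
  view := rfl
  entered := .inl rfl
  requested := by simp [msgs, initial]
  hist := .inl rfl

theorem Inv.receive (h : s.Inv P i) {inbox : List (Msg N Client Op Res)}
    (hin : ∀ x ∈ inbox, x.author = some i → x ∈ s.msgs) : (s.receive t inbox).Inv P i := by
  have hmem : ∀ x ∈ (s.receive t inbox).msgs, x.author = some i → x ∈ s.msgs := fun x hx hi =>
    (mem_msgs_receive.1 hx).elim id fun hx => hin x hx hi
  have hle := (s.le_receive t inbox).msgs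
  exact {
    certified := fun k b hx => h.certified k b (hmem _ hx rfl)
    own := h.own.mono hle
    view := h.view
    entered := h.entered.imp_right fun ⟨⟨Q, hQ, hr⟩, hO⟩ =>
      ⟨⟨Q, hQ, fun r hrQ => (hr r hrQ).imp fun _ hw => hle hw⟩, hO⟩
    requested := fun w v hx => h.requested w v (hmem _ hx rfl)
    hist := h.hist.imp_right fun hd => hd.mono hle }

theorem Inv.hold (h : s.Inv P i) {x : Msg N Client Op Res}
    (hc : ∀ r k b, x ≠ .certified r k b)
    (hr : ∀ w v, x = .reqViewChange i w v → v ≤ s.view + 1) : (s.hold t x).Inv P i := by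
  have hle := (s.le_hold t x).msgs
  exact {
    certified := fun k b hx => by
      rw [msgs_hold] at hx
      exact h.certified k b (hx.resolve_left fun he => hc _ _ _ he.symm)
    own := h.own.mono hle
    view := h.view
    entered := h.entered.imp_right fun ⟨⟨Q, hQ, hr⟩, hO⟩ =>
      ⟨⟨Q, hQ, fun r hrQ => (hr r hrQ).imp fun _ hw => hle hw⟩, hO⟩
    requested := fun w v hx => by
      rw [msgs_hold] at hx
      exact hx.elim (fun he => hr w v he.symm) (h.requested w v)
    hist := h.hist.imp_right fun hd => hd.mono hle }

theorem Inv.certified_issue (h : s.Inv P i) {b : Body N Client Op} (k : ℕ)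
    (b' : Body N Client Op) (hx : .certified i k b' ∈ (s.issue i t b).msgs) :
    (s.own ++ [b])[k]? = some b' := by
  rw [msgs_issue] at hx
  rcases hx with he | hx
  · injection he with _ hk hb
    subst hk hb
    simp
  · have := h.certified k b' hx
    rwa [List.getElem?_append_left (List.getElem?_eq_some_iff.1 this).1]

theorem Inv.issue (h : s.Inv P i) {b : Body N Client Op} (hb : s.MayIssue P.f i b)
    (hv : curView (s.own ++ [b]) = curView s.own) : (s.issue i t b).Inv P i := by
  have hle := (s.le_issue i t b).msgs
  exact {
    certified := h.certified_issue
    own := by rw [msgs_issue]; exact hb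
    view := hv.trans h.view
    entered := h.entered.imp_right fun ⟨⟨Q, hQ, hr⟩, hO⟩ =>
      ⟨⟨Q, hQ, fun r hrQ => (hr r hrQ).imp fun _ hw => hle hw⟩,
        hO.imp fun _ hO => hO.trans (List.prefix_append _ _)⟩
    requested := fun w v hx => h.requested w v (by simpa using hx)
    hist := h.hist.imp_right fun hd => hd.mono hle }

end Replica

open Replica

theorem Act.le (h : Act P svc i t s s') : s.Le s' := by
  cases h with
  | prepare => exact s.le_issue _ _ _
  | commit => exact s.le_issue _ _ _
  | execute h _ hp _ => exact ⟨fun _ h => h, hp, le_rfl, fun _ => rfl⟩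
  | reply => exact s.le_hold _ _
  | timeout => exact s.le_hold _ _
  | enterView v Q hv _ _ =>
    exact ⟨(s.le_issue _ _ _).held, List.prefix_rfl, hv.le, fun he => absurd he hv.ne⟩
  | newView => exact s.le_issue _ _ _

/-- Messages that a replica generates are signed by it. -/
theorem Act.author_of_mem (h : Act P svc i t s s') {x : Msg N Client Op Res}
    (hx : x ∈ s'.msgs) : x ∈ s.msgs ∨ x.author = some i := by
  have hi : ∀ b, x ∈ (s.issue i t b).msgs → x ∈ s.msgs ∨ x.author = some i := by
    intro b hx
    rw [msgs_issue] at hx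
    exact hx.symm.imp_right fun he => by rw [he]; rfl
  cases h with
  | prepare => exact hi _ hx
  | commit => exact hi _ hx
  | execute h _ hp _ => exact .inl hx
  | reply => rw [msgs_hold] at hx; exact hx.symm.imp_right fun he => by rw [he]; rfl
  | timeout => rw [msgs_hold] at hx; exact hx.symm.imp_right fun he => by rw [he]; rfl
  | enterView v Q hv _ _ => exact hi (.viewChange v s.own) hx
  | newView => exact hi _ hx

theorem Act.inv (h : Act P svc i t s s') (hs : s.Inv P i) : s'.Inv P i := by
  cases h with
  | prepare _ _ _ hm => exact hs.issue hm (by simp)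
  | commit _ _ hm => exact hs.issue hm (by simp)
  | execute h hd _ _ => exact { hs with hist := .inr hd }
  | reply => exact hs.hold (by simp) (by simp)
  | timeout => exact hs.hold (by simp) (by rintro _ _ he; injection he; omega)
  | enterView v Q hv hQ hr =>
    have hle := (s.le_issue i t (.viewChange v s.own)).msgs
    have hmem : (.certified i s.own.length (.viewChange v s.own)) ∈
        (s.issue i t (.viewChange v s.own)).msgs := by rw [msgs_issue]; exact .inl rfl
    exact {
      certified := hs.certified_issue
      own := .viewChange (hs.own.mono hle) hmem (hs.view ▸ hv)
      view := curView_append_viewChange _ _ _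
      entered := .inr ⟨⟨Q, hQ, fun r hrQ => (hr r hrQ).imp fun _ hw => hle hw⟩, s.own,
        List.prefix_rfl⟩
      requested := fun w v' hx => by
        have hx' : Msg.reqViewChange i w v' ∈ (s.issue i t (.viewChange v s.own)).msgs := hx
        have := hs.requested w v' (by simpa using hx')
        exact this.trans (by simpa using hv.le)
      hist := hs.hist.imp_right fun hd => hd.mono hle }
  | newView V S hm => exact hs.issue hm (by simp)

/-- Nothing is left to do for replica `i` in state `s` at tick `t`. -/
def Quiet (P : Params) (svc : Service Op Res St) (i : Fin N) (t : ℕ)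
    (s : Replica N Client Op Res) : Prop :=
  ∀ s', ¬ Act P svc i t s s'

/-- Were the commit missing, issuing it would be an enabled action. The next two lemmas use
quietness in the same way. -/
theorem Quiet.commit_mem (h : Quiet P svc i t s) (hs : s.Inv P i)
    {l : List (Body N Client Op)} {b : Body N Client Op}
    (hl : Accepted P.f s.msgs (primary N s.view) (l ++ [b])) (hb : IsProposal s.view b) :
    Body.commit s.view l.length ∈ s.own := by
  by_contra hc
  exact h _ (.commit s _ hc (.commit (hs.own.mono (Set.subset_insert _ _)) (.inl rfl) hs.view
    (hl.mono (Set.subset_insert _ _)) rfl hb))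

theorem Quiet.stale (h : Quiet P svc i t s) (hs : s.Inv P i) (hi : i = primary N s.view)
    (hopen : ∃ V S, Body.newView s.view V S ∈ s.own) {m : Command Client Op}
    (hm : .request m ∈ s.msgs) : Stale (histOf s.view s.own) m := by
  by_contra hst
  exact h _ (.prepare s m hm hst (.prepare (hs.own.mono (Set.subset_insert _ _)) (.inl rfl)
    (.inr hm) hi hs.view (.inr hopen)))

theorem Quiet.newView_mem (h : Quiet P svc i t s) (hs : s.Inv P i) (hi : i = primary N s.view)
    {R : Finset (Fin N)} (hR : N ≤ R.card + P.f)
    (hV : ∀ r ∈ R, ∃ O, Accepted P.f s.msgs r (O ++ [.viewChange s.view O])) :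
    ∃ V S, Body.newView s.view V S ∈ s.own := by
  by_contra hno
  choose! O hO using hV
  set V : List (Fin N × List (Body N Client Op)) := R.toList.map fun r => (r, O r) with hVdef
  have hlen : N ≤ V.length + P.f := by simpa [hVdef] using hR
  have hfst : (V.map Prod.fst).Nodup := by
    have : V.map Prod.fst = R.toList := by simp [hVdef, Function.comp_def]
    rw [this]
    exact R.nodup_toList
  have hacc : ∀ e ∈ V, Accepted P.f s.msgs e.1 (e.2 ++ [.viewChange s.view e.2]) := by
    intro e he
    obtain ⟨r, hr, rfl⟩ := List.mem_map.1 he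
    exact hO r (Finset.mem_toList.1 hr)
  have hsub : ∀ b, s.msgs ⊆ insert (.certified i s.own.length b) s.msgs :=
    fun _ => Set.subset_insert _ _
  -- A valid `newView` always exists: if the logs vouch for anything, there is a latest vouched
  -- proposal, and the acceptance of the vouching log supplies the primary's log up to it.
  by_cases hvouch : ∃ e ∈ V, ∃ w k, Vouches e.2 w k
  · obtain ⟨w, k, ⟨e, he, hwk⟩, hmax⟩ := exists_latest_vouched hvouch
    obtain ⟨-, l', b, hl', hk, -⟩ := (accepted_append_iff.1 (hacc e he)).1.of_vouches hwk
    exact h _ (.newView s V (histOf w (l' ++ [b])) (.newView (hs.own.mono (hsub _)) (.inl rfl) hi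
      hs.view hno hlen hfst (fun e he => (hacc e he).mono (hsub _)) ⟨e, he, hwk⟩ hmax
      (hl'.mono (hsub _)) (by simp [hk])))
  · push Not at hvouch
    exact h _ (.newView s V [] (.newViewEmpty (hs.own.mono (hsub _)) (.inl rfl) hi hs.view hno hlen
      hfst (fun e he => (hacc e he).mono (hsub _)) hvouch))

end States

/-! ### Runs: authenticity and the minimal duration of a view -/

section Runs

variable {N : ℕ} [NeZero N] {Client Op Res St : Type*} {P : Params} {svc : Service Op Res St}
  {X : Execution N Client Op Res} {R : Finset (Fin N)} {C : Set Client} {i j : Fin N} {t t' : ℕ}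

open Replica

/-- A property of states that the receipt of the inbox and every action preserve holds after the
tick. -/
theorem CorrectReplica.tick_induction (h : CorrectReplica P svc X i)
    {p : Replica N Client Op Res → Prop}
    (hr : p ((X.replica t i).receive t (X.inbox t i)))
    (ha : ∀ s s', p s → Act P svc i t s s' → p s') : p (X.replica (t + 1) i) := by
  have := (h.2 t).1
  generalize X.replica (t + 1) i = s at this ⊢
  induction this with
  | refl => exact hr
  | tail _ h ih => exact ha _ _ ih h

theorem CorrectReplica.quiet (h : CorrectReplica P svc X i) (t : ℕ) :
    Quiet P svc i t (X.replica (t + 1) i) :=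
  (h.2 t).2

theorem CorrectReplica.le (h : CorrectReplica P svc X i) (ht : t ≤ t') :
    (X.replica t i).Le (X.replica t' i) := by
  induction t', ht using Nat.le_induction with
  | base => exact .refl _
  | succ t' _ ih =>
    exact h.tick_induction (p := fun s => (X.replica t i).Le s) (ih.trans (le_receive _ _ _))
      fun s s' hs ha => hs.trans ha.le

theorem CorrectReplica.mem_of_inbox (h : CorrectReplica P svc X i) {x : Msg N Client Op Res}
    (hx : x ∈ X.inbox t i) : x ∈ (X.replica (t + 1) i).msgs :=
  h.tick_induction (p := fun s => x ∈ s.msgs) (mem_msgs_receive.2 (.inr hx))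
    fun _ _ hs ha => ha.le.msgs hs

theorem CorrectReplica.not_mem_zero (h : CorrectReplica P svc X i) (x : Msg N Client Op Res) :
    x ∉ (X.replica 0 i).msgs := by
  rw [h.1]
  simp [msgs, initial]

/-- A replica gets the messages that it did not generate from its inbox. -/
theorem CorrectReplica.inbox_of_mem (h : CorrectReplica P svc X i) {x : Msg N Client Op Res}
    (hx : x ∈ (X.replica t i).msgs) (hi : x.author ≠ some i) : ∃ t' < t, x ∈ X.inbox t' i := by
  induction t with
  | zero => exact absurd hx (h.not_mem_zero x)
  | succ t ih =>
    revert hx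
    refine h.tick_induction (p := fun s => x ∈ s.msgs → ∃ t' < t + 1, x ∈ X.inbox t' i)
      (fun hx => ?_) fun s s' hs ha hx => hs ((ha.author_of_mem hx).resolve_right hi)
    rcases mem_msgs_receive.1 hx with hx | hx
    · obtain ⟨t', ht', hx⟩ := ih hx
      exact ⟨t', by omega, hx⟩
    · exact ⟨t, by omega, hx⟩

/-- The assumptions on the parameters, the correct replicas and the authenticity of messages in a run. -/
structure Faithful (P : Params) (svc : Service Op Res St) (X : Execution N Client Op Res)
    (R : Finset (Fin N)) (C : Set Client) : Prop where
  lt : 2 * P.f + 1 ≤ N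
  le_q : P.f + 1 ≤ P.q
  q_le : P.q + P.f ≤ N
  card : N ≤ R.card + P.f
  replica : ∀ i ∈ R, CorrectReplica P svc X i
  auth : Authentic X R C

/-- The messages that correct replicas ever hold. -/
def Known (X : Execution N Client Op Res) (R : Finset (Fin N)) : Set (Msg N Client Op Res) :=
  {x | ∃ t, ∃ i ∈ R, x ∈ (X.replica t i).msgs}

namespace Faithful

variable (H : Faithful P svc X R C)
include H

theorem inv (hi : i ∈ R) (t : ℕ) : (X.replica t i).Inv P i := by
  induction t with
  | zero => rw [(H.replica i hi).1]; exact inv_initial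
  | succ t ih =>
    exact (H.replica i hi).tick_induction
      (ih.receive fun x hx ha => H.auth.replica t i hi x hx i hi ha) fun s s' hs ha => ha.inv hs

theorem mem_author (hi : i ∈ R) (hj : j ∈ R) {x : Msg N Client Op Res}
    (hx : x ∈ (X.replica t j).msgs) (ha : x.author = some i) : x ∈ (X.replica t i).msgs := by
  by_cases hij : x.author = some j
  · obtain rfl : i = j := Option.some.inj (ha.symm.trans hij)
    exact hx
  · obtain ⟨t', ht', hx⟩ := (H.replica j hj).inbox_of_mem hx hij
    exact ((H.replica i hi).le ht'.le).msgs (H.auth.replica t' j hj x hx i hi ha)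

omit H in
theorem msgs_subset_known (hi : i ∈ R) : (X.replica t i).msgs ⊆ Known X R :=
  fun _ hx => ⟨t, i, hi, hx⟩

/-- For a correct owner, both certificates must agree with its own log. Certificates of a faulty
owner came through inboxes, where the USIG assumption applies. -/
theorem uniqueCertificates : UniqueCertificates (Known X R) := by
  rintro r k b b' ⟨t, i, hi, hx⟩ ⟨t', j, hj, hx'⟩
  by_cases hr : r ∈ R
  · have h := (H.inv hr (max t t')).certified k b
      (((H.replica r hr).le (le_max_left _ _)).msgs (H.mem_author hr hi hx rfl))
    have h' := (H.inv hr (max t t')).certified k b'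
      (((H.replica r hr).le (le_max_right _ _)).msgs (H.mem_author hr hj hx' rfl))
    exact Option.some.inj (h.symm.trans h')
  · obtain ⟨_, -, hx⟩ := (H.replica i hi).inbox_of_mem hx
      (by rintro ⟨⟩; exact hr hi)
    obtain ⟨_, -, hx'⟩ := (H.replica j hj).inbox_of_mem hx'
      (by rintro ⟨⟩; exact hr hj)
    exact H.auth.usig _ _ i hi j hj r k b b' hx hx'

theorem submitted {m : Command Client Op} (hm : .request m ∈ Known X R) (hc : m.client ∈ C) :
    ∃ t, X.submits t m := by
  obtain ⟨t, i, hi, hx⟩ := hm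
  obtain ⟨t', -, hx⟩ := (H.replica i hi).inbox_of_mem hx (by rintro ⟨⟩)
  obtain ⟨t, -, h⟩ := H.auth.client t' i hi m hx hc
  exact ⟨t, h⟩

theorem nonempty : R.Nonempty := by
  rw [← Finset.card_pos]
  have := H.lt
  have := H.card
  omega

/-- If `q` replicas request a view, a correct one is among them. -/
theorem exists_correct {Q : Finset (Fin N)} (hQ : P.q ≤ Q.card) : ∃ r ∈ Q, r ∈ R := by
  have hlt : (Finset.univ : Finset (Fin N)).card < Q.card + R.card := by
    have := H.le_q
    have := H.card
    rw [Finset.card_fin]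
    omega
  obtain ⟨r, hr⟩ := Finset.inter_nonempty_of_card_lt_card_add_card (Finset.subset_univ Q)
    (Finset.subset_univ R) hlt
  exact ⟨r, Finset.mem_inter.1 hr⟩

/-- No correct replica leaves view `v` before its timeout has passed since a time when all of them
were in earlier views. -/
theorem view_le {T v : ℕ} (hT : ∀ i ∈ R, (X.replica T i).view < v) (ht : T ≤ t)
    (ht' : t ≤ T + P.timeout v) : ∀ i ∈ R, (X.replica t i).view ≤ v := by
  -- Strengthened for the induction on time: view `v` was entered no earlier than `T`, and no
  -- correct replica has requested a view above `v`.
  suffices h : ∀ i ∈ R, (X.replica t i).view ≤ v ∧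
      ((X.replica t i).view = v → T ≤ (X.replica t i).since) ∧
      ∀ r ∈ R, ∀ w v', .reqViewChange r w v' ∈ (X.replica t i).msgs → v' ≤ v from
    fun i hi => (h i hi).1
  induction t, ht using Nat.le_induction with
  | base =>
    refine fun i hi => ⟨(hT i hi).le, fun he => absurd he (hT i hi).ne, fun r hr w v' hx => ?_⟩
    exact ((H.inv hr T).requested w v' (H.mem_author hr hi hx rfl)).trans (hT r hr)
  | succ t hTt ih =>
    specialize ih (by omega)
    intro i hi
    refine (H.replica i hi).tick_induction (p := fun s => s.view ≤ v ∧ (s.view = v → T ≤ s.since) ∧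
      ∀ r ∈ R, ∀ w v', .reqViewChange r w v' ∈ s.msgs → v' ≤ v)
      ⟨(ih i hi).1, (ih i hi).2.1, fun r hr w v' hx => ?_⟩ ?_
    · rcases mem_msgs_receive.1 hx with hx | hx
      · exact (ih i hi).2.2 r hr w v' hx
      -- A message received from a correct `r` was already held by `r` before this tick, so the
      -- induction hypothesis for `r` covers it.
      · exact (ih r hr).2.2 r hr w v' (H.auth.replica t i hi _ hx r hr rfl)
    · rintro s s' ⟨h₁, h₂, h₃⟩ ha
      have hissue : ∀ b, ∀ r ∈ R, ∀ w v',
          .reqViewChange r w v' ∈ (s.issue i t b).msgs → v' ≤ v :=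
        fun b r hr w v' hx => h₃ r hr w v' (by simpa using hx)
      cases ha with
      | prepare => exact ⟨h₁, h₂, hissue _⟩
      | commit => exact ⟨h₁, h₂, hissue _⟩
      | execute => exact ⟨h₁, h₂, h₃⟩
      | reply => exact ⟨h₁, h₂, fun r hr w v' hx => h₃ r hr w v' (by simpa using hx)⟩
      | newView => exact ⟨h₁, h₂, hissue _⟩
      | timeout hs _ _ =>
        refine ⟨h₁, h₂, fun r hr w v' hx => ?_⟩
        rw [msgs_hold] at hx
        rcases hx with he | hx
        · injection he with _ _ he
          subst he
          -- Requesting `v + 1` would need the timer of view `v`, started at `T` or later, to have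
          -- expired before `T + P.timeout v`.
          refine lt_of_le_of_ne h₁ fun hv => ?_
          have := h₂ hv
          rw [hv] at hs
          omega
        · exact h₃ r hr w v' hx
      | enterView v' Q hv hQ hQ' =>
        obtain ⟨r, hrQ, hr⟩ := H.exists_correct hQ
        obtain ⟨w, hw⟩ := hQ' r hrQ
        exact ⟨h₃ r hr w v' hw, fun _ => hTt, hissue (.viewChange v' s.own)⟩

end Faithful

end Runs

/-! ### Liveness: view changes, a stable view, completion -/

section Liveness

variable {N : ℕ} [NeZero N] {Client Op Res St : Type*} {P : Params} {svc : Service Op Res St}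
  {X : Execution N Client Op Res} {R : Finset (Fin N)} {C : Set Client} {i j : Fin N} {t t' : ℕ}
  {G D : ℕ} {m : Command Client Op}

open Replica

theorem Executes.of_prefix {h h' : List (Command Client Op)} {res : Res} (hh : h <+: h')
    (he : Executes svc h m res) : Executes svc h' m res := by
  obtain ⟨h₁, h₂, rfl, hs, hr⟩ := he
  obtain ⟨h₃, rfl⟩ := hh
  exact ⟨h₁, h₂ ++ h₃, by simp, hs, hr⟩

/-- From time `G` on, what a correct replica holds reaches every correct replica within `D`
ticks. -/
def Delivers (X : Execution N Client Op Res) (R : Finset (Fin N)) (G D : ℕ) : Prop :=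
  ∀ t, G ≤ t → ∀ i ∈ R, ∀ j ∈ R, (X.replica t i).msgs ⊆ (X.replica (t + D) j).msgs

namespace Faithful

variable (H : Faithful P svc X R C)
include H

theorem quiet (hi : i ∈ R) (ht : 0 < t) : ∃ t', Quiet P svc i t' (X.replica t i) := by
  obtain ⟨t, rfl⟩ := Nat.exists_eq_succ_of_ne_zero ht.ne'
  exact ⟨t, (H.replica i hi).quiet t⟩

theorem delivers {GST Δ : ℕ} (hsync : ∀ t, ∀ i ∈ R, ∀ x ∈ (X.replica t i).msgs, ∀ j ∈ R,
    ∃ t' ≤ max t GST + Δ, x ∈ X.inbox t' j) : Delivers X R GST (Δ + 1) := by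
  intro t ht i hi j hj x hx
  obtain ⟨t', ht', hx⟩ := hsync t i hi x hx j hj
  rw [max_eq_left ht] at ht'
  -- What arrives at tick `t'` appears in the state at `t' + 1`; hence the delay `Δ + 1`.
  exact ((H.replica j hj).le (by omega)).msgs ((H.replica j hj).mem_of_inbox hx)

/-- Every correct replica goes through what is decided according to the messages it holds. -/
theorem prefix_hist (hi : i ∈ R) (ht : 0 < t) {h : List (Command Client Op)}
    (hd : Decided P.f (X.replica t i).msgs h) : h <+: (X.replica t i).hist := by
  obtain ⟨t', hq⟩ := H.quiet hi ht
  have hcases : h <+: (X.replica t i).hist ∨ (X.replica t i).hist <+: h := by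
    rcases (H.inv hi t).hist with h₀ | hd'
    · exact .inr (h₀ ▸ List.nil_prefix)
    · have := H.lt
      exact (hd.mono (msgs_subset_known hi)).prefix_or_prefix H.uniqueCertificates (by omega)
        (hd'.mono (msgs_subset_known hi))
  rcases hcases with hle | hle
  · exact hle
  · by_contra hne
    exact hq _ (.execute _ h hd hle fun he => hne (he ▸ List.prefix_rfl))

/-- The `q` requests that brought `i` into its view are forwarded to `j` and bring it there too.
Positivity of `D` ensures that the later state follows a completed tick, hence is quiet. -/
theorem le_view_of_delivers (hD : Delivers X R G D) (hD₀ : 0 < D) (ht : G ≤ t) (hi : i ∈ R)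
    (hj : j ∈ R) : (X.replica t i).view ≤ (X.replica (t + D) j).view := by
  by_contra! hlt
  obtain ⟨t', hq⟩ := H.quiet hj (t := t + D) (by omega)
  rcases (H.inv hi t).entered with h₀ | ⟨⟨Q, hQ, hr⟩, -⟩
  · omega
  · exact hq _ (.enterView _ _ Q hlt hQ fun r hrQ =>
      (hr r hrQ).imp fun _ hw => hD t ht i hi j hj hw)

/-- If a correct replica has executed the last request of a correct client, the request
completes. -/
theorem completed (hD : Delivers X R G D) (hD₀ : 0 < D)
    (hreply : ∀ t, ∀ i ∈ R, ∀ r id res, .reply r m.client id res ∈ (X.replica t i).msgs →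
      ∃ t', .reply r m.client id res ∈ X.clientInbox t' m.client)
    (hlast : ∀ m', .request m' ∈ Known X R → m'.client = m.client → m.id ≤ m'.id → m' = m)
    (hi : i ∈ R) (hm : m ∈ (X.replica t i).hist) : ∃ t', Completed P.f X m t' := by
  set h := (X.replica t i).hist with hh
  have hd : Decided P.f (X.replica t i).msgs h := by
    rcases (H.inv hi t).hist with h₀ | hd
    · rw [← hh] at h₀
      simp [h₀] at hm
    · exact hd
  -- Split at the first occurrence of `m`. A command in `h₁` making `m` stale would be `m` itself by
  -- `hlast`.
  obtain ⟨h₁, h₂, hsplit, hm₁⟩ := List.eq_append_cons_of_mem hm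
  have hex : Executes svc h m (svc.apply (run svc h₁) m.op).2 := by
    refine ⟨h₁, h₂, hsplit, ?_, rfl⟩
    rintro ⟨m', hm', hc, hid⟩
    refine hm₁ (hlast m' (msgs_subset_known hi (hd.request_mem ?_)) hc hid ▸ hm')
    rw [hsplit]
    exact List.mem_append_left _ hm'
  have hrep : ∀ j ∈ R, ∃ t', .reply j m.client m.id (svc.apply (run svc h₁) m.op).2 ∈
      X.clientInbox t' m.client := by
    intro j hj
    have hle : (X.replica t i).msgs ⊆ (X.replica (max t G + D) j).msgs :=
      ((H.replica i hi).le (le_max_left t G)).msgs.trans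
        (hD _ (le_max_right _ _) i hi j hj)
    have hp := H.prefix_hist hj (by omega) (hd.mono hle)
    obtain ⟨t', hq⟩ := H.quiet hj (t := max t G + D) (by omega)
    refine hreply (max t G + D) j hj j m.id _ ?_
    by_contra hno
    exact hq _ (.reply _ m _ (hex.of_prefix hp) hno)
  choose! T hT using hrep
  refine ⟨R.sup T, _, R, ?_, fun r hr => ⟨T r, Finset.le_sup hr, hT r hr⟩⟩
  have := H.lt
  have := H.card
  omega

/-- As long as no correct replica executes the request `m`, correct replicas change views. -/
theorem exists_le_view (hD : Delivers X R G D) (hD₀ : 0 < D)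
    (hm : ∀ i ∈ R, ∃ t, .request m ∈ (X.replica t i).msgs)
    (hno : ∀ t, ∀ i ∈ R, ¬ Stale (X.replica t i).hist m) (v : ℕ) :
    ∃ t, ∃ i ∈ R, v ≤ (X.replica t i).view := by
  induction v with
  | zero =>
    obtain ⟨i, hi⟩ := H.nonempty
    exact ⟨0, i, hi, Nat.zero_le _⟩
  | succ v ih =>
    by_contra! hlt
    obtain ⟨t, i, hi, hv⟩ := ih
    -- If view `v + 1` is never reached, all correct replicas end up in `v` for good, with their
    -- timers running.
    have hview : ∀ j ∈ R, ∀ t', max t G + D ≤ t' → (X.replica t' j).view = v := by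
      intro j hj t' ht'
      have h₁ := ((H.replica i hi).le (le_max_left t G)).view
      have h₂ := H.le_view_of_delivers hD hD₀ (le_max_right t G) hi hj
      have h₃ := ((H.replica j hj).le ht').view
      have := hlt t' j hj
      omega
    have hreq : ∀ j ∈ R, ∀ᶠ t' in atTop,
        .reqViewChange j v (v + 1) ∈ (X.replica t' j).msgs := by
      intro j hj
      obtain ⟨t₁, t₀, ht₀⟩ := hm j hj
      set t₂ := max t G + D
      -- By then both waiting periods are over, the one since entering `v` and the one since
      -- obtaining `m` at `t₀`; the final `+ 1` makes the state one that follows a tick.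
      filter_upwards [eventually_ge_atTop
        (max t₁ (max t₂ ((X.replica t₂ j).since + t₀ + P.timeout v)) + 1)] with t' ht'
      obtain ⟨t', rfl⟩ := Nat.exists_eq_add_of_lt (show 0 < t' by omega)
      rw [Nat.zero_add] at ht' ⊢
      have hv' := hview j hj (t' + 1) (by omega)
      have hs := ((H.replica j hj).le (show t₂ ≤ t' + 1 by omega)).since
        (by rw [hview j hj _ le_rfl, hv'])
      by_contra hno'
      refine (H.replica j hj).quiet t' _ (.timeout _ ?_ (.inr ⟨t₀, m, ?_, ?_, hno _ j hj⟩) ?_)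
      · rw [hv', ← hs]
        omega
      · exact ((H.replica j hj).le (show t₁ ≤ t' + 1 by omega)).held ht₀
      · rw [hv']
        omega
      · rwa [hv']
    obtain ⟨t₃, ht₃⟩ := ((Filter.eventually_all_finset R).2 hreq).exists_forall_of_atTop
    set t₄ := max t₃ (max t G + D)
    have hG : G ≤ t₄ := by omega
    obtain ⟨t', hq⟩ := H.quiet hi (t := t₄ + D) (by omega)
    have hv' := hview i hi (t₄ + D) (by omega)
    refine hq _ (.enterView _ (v + 1) R (by omega) ?_ fun r hr => ⟨v, ?_⟩)
    · have := H.q_le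
      have := H.card
      omega
    · exact hD t₄ hG r hr i hi (ht₃ t₄ (le_max_left _ _) r hr)

/-- If all correct replicas stay in a view with a correct primary for three message delays, they
execute all the requests that they hold. -/
theorem mem_hist_of_stable {v : ℕ} (hv₀ : 0 < v) (hp : primary N v ∈ R)
    (hD : Delivers X R G D) (hD₀ : 0 < D) (hG : G ≤ t)
    (hm : ∀ i ∈ R, .request m ∈ (X.replica t i).msgs)
    (hlast : ∀ m', .request m' ∈ Known X R → m'.client = m.client → m.id ≤ m'.id → m' = m)
    (hstable : ∀ t', t ≤ t' → t' ≤ t + 3 * D → ∀ i ∈ R, (X.replica t' i).view = v)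
    (hi : i ∈ R) : m ∈ (X.replica (t + 3 * D) i).hist := by
  have hv₁ := hstable (t + D) (by omega) (by omega) _ hp
  obtain ⟨t₁, hq⟩ := H.quiet hp (t := t + D) (by omega)
  have hinv := H.inv hp (t + D)
  -- First delay: all correct replicas were in `v > 0` at `t`, so their `viewChange` messages, at
  -- least N - f, have reached the primary.
  have hopen : ∃ V S, Body.newView v V S ∈ (X.replica (t + D) (primary N v)).own := by
    have := hq.newView_mem hinv (by rw [hv₁]) H.card fun r hr => ?_
    · rwa [hv₁] at this
    · rcases (H.inv hr t).entered with h₀ | ⟨-, O, hO⟩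
      · rw [hstable t le_rfl (by omega) r hr] at h₀
        omega
      · rw [hstable t le_rfl (by omega) r hr] at hO
        rw [hv₁]
        exact ⟨O, ((H.inv hr t).own.of_prefix hO).mono (hD t hG r hr _ hp)⟩
  set L := (X.replica (t + D) (primary N v)).own
  have hmL : m ∈ histOf v L := by
    have := hq.stale hinv (by rw [hv₁]) (by rw [hv₁]; exact hopen)
      (((H.replica _ hp).le (Nat.le_add_right t D)).msgs (hm _ hp))
    rw [hv₁] at this
    obtain ⟨m', hm', hc, hid⟩ := this
    rwa [← hlast m' (msgs_subset_known hp (hinv.own.request_mem hm')) hc hid]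
  have hL : Accepted P.f (X.replica (t + D) (primary N v)).msgs (primary N v) L := hinv.own
  -- Second delay: the proposals reach all correct replicas, which are still in view `v` and commit.
  have hcommit : ∀ j ∈ R, ∀ k b, L[k]? = some b → IsProposal v b →
      Body.commit v k ∈ (X.replica (t + D + D) j).own := by
    intro j hj k b hk hb
    obtain ⟨t₂, hq⟩ := H.quiet hj (t := t + D + D) (by omega)
    have hv₂ := hstable (t + D + D) (by omega) (by omega) j hj
    have := hq.commit_mem (H.inv hj _) (l := L.take k) (b := b)
      (by rw [hv₂]; exact (hL.take_append hk).mono (hD _ (by omega) _ hp j hj)) (by rwa [hv₂])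
    rwa [hv₂, List.length_take_of_le (List.getElem?_eq_some_iff.1 hk).1.le] at this
  obtain ⟨V, S, hVS⟩ := hopen
  -- `Decided` wants a log ending in a proposal, so `L` is cut after its last one, which leaves the
  -- sequence unchanged.
  obtain ⟨l, b, hl, hb, hhist⟩ := exists_last_proposal L ⟨_, hVS, .inr ⟨V, S, rfl⟩⟩
  have h3 : t + 3 * D = t + D + D + D := by omega
  rw [h3]
  have hi₁ : (X.replica (t + D) (primary N v)).msgs ⊆ (X.replica (t + D + D + D) i).msgs :=
    (hD _ (by omega) _ hp i hi).trans ((H.replica i hi).le (Nat.le_add_right _ _)).msgs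
  -- Third delay: the commits reach `i`, and `R` itself serves as the quorum of every certificate.
  have hd : Decided P.f (X.replica (t + D + D + D) i).msgs (histOf v L) := by
    refine ⟨v, l, b, (hL.of_prefix hl).mono hi₁, hb, fun k b' hk hb' => ?_, hhist.symm⟩
    refine ⟨R, ?_, fun r hr => ?_⟩
    · have := H.lt
      have := H.card
      omega
    · have hkL : L[k]? = some b' := by
        obtain ⟨rest, hrest⟩ := hl
        rw [← hrest, List.getElem?_append_left (List.getElem?_eq_some_iff.1 hk).1, hk]
      obtain ⟨n, hn⟩ := List.mem_iff_getElem?.1 (hcommit r hr k b' hkL hb')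
      exact ⟨_, ((H.inv hr _).own.take_append hn).mono (hD _ (by omega) r hr i hi)⟩
  exact (H.prefix_hist hi (by omega) hd).subset hmL

/-- Some correct replica executes the last request of a correct client. -/
theorem exists_mem_hist (htimeout : Tendsto P.timeout atTop atTop)
    (hD : Delivers X R G D) (hD₀ : 0 < D)
    (hm : ∀ i ∈ R, ∃ t, .request m ∈ (X.replica t i).msgs)
    (hlast : ∀ m', .request m' ∈ Known X R → m'.client = m.client → m.id ≤ m'.id → m' = m) :
    ∃ t, ∃ i ∈ R, m ∈ (X.replica t i).hist := by
  by_contra! hno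
  have hstale : ∀ t, ∀ i ∈ R, ¬ Stale (X.replica t i).hist m := by
    rintro t i hi ⟨m', hm', hc, hid⟩
    rcases (H.inv hi t).hist with h₀ | hd
    · simp [h₀] at hm'
    · exact hno t i hi (hlast m' (msgs_subset_known hi (hd.request_mem hm')) hc hid ▸ hm')
  obtain ⟨T₀, hT₀⟩ := ((Filter.eventually_all_finset R).2 fun i hi =>
    show ∀ᶠ t in atTop, .request m ∈ (X.replica t i).msgs by
      obtain ⟨t, ht⟩ := hm i hi
      filter_upwards [eventually_ge_atTop t] with t' htt'
      exact ((H.replica i hi).le htt').msgs ht).exists_forall_of_atTop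
  set T₁ := max T₀ G
  obtain ⟨r, hr⟩ := H.nonempty
  obtain ⟨n, hn, hn'⟩ : ∃ n, (∀ i ∈ R, ∀ v, n ≤ v → (X.replica T₁ i).view < v) ∧
      ∀ v, n ≤ v → 4 * D + 2 ≤ P.timeout v := by
    -- With all correct replicas below `v` at `T` and one of them in `v` or above at `T + 1`, view
    -- `v` must last until `T + 1 + D + 3 * D`, which is below `T + (4 * D + 2)`.
    obtain ⟨n, hn⟩ := (htimeout.eventually_ge_atTop (4 * D + 2)).exists_forall_of_atTop
    refine ⟨max n (R.sup (fun i => (X.replica T₁ i).view) + 1), fun i hi v hv => ?_,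
      fun v hv => hn v ((le_max_left _ _).trans hv)⟩
    have := Finset.le_sup (f := fun i => (X.replica T₁ i).view) hi
    omega
  -- A view at least `n` whose primary is the correct replica `r`.
  set v := r.val + N * n with hv
  have hnv : n ≤ v := (Nat.le_mul_of_pos_left n (NeZero.pos N)).trans (Nat.le_add_left _ _)
  have hp : primary N v = r := by
    apply Fin.ext
    simp [primary, Fin.ofNat, hv, Nat.mod_eq_of_lt r.isLt]
  classical
  have hex := H.exists_le_view hD hD₀ hm hstale v
  obtain ⟨i, hi, hiv⟩ := Nat.find_spec hex
  have hmin : ∀ t < Nat.find hex, ∀ j ∈ R, (X.replica t j).view < v := by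
    intro t ht j hj
    by_contra! hle
    exact Nat.find_min hex ht ⟨j, hj, hle⟩
  have hlt : T₁ < Nat.find hex := by
    by_contra! hle
    exact absurd ((hn i hi v hnv).trans_le hiv) (not_lt.2 ((H.replica i hi).le hle).view)
  -- `T + 1` is the first time at which a correct replica has reached view `v`.
  obtain ⟨T, hT⟩ := Nat.exists_eq_add_of_lt ((Nat.zero_le T₁).trans_lt hlt)
  rw [Nat.zero_add] at hT
  rw [hT] at hiv hmin hlt
  have hto := hn' v hnv
  have hGT : G ≤ T + 1 := by omega
  refine hno (T + 1 + D + 3 * D) i hi (H.mem_hist_of_stable (v := v) ?_ (hp ▸ hr) hD hD₀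
    (by omega) (fun j hj => hT₀ _ (by omega) j hj) hlast (fun t ht ht' j hj => ?_) hi)
  · exact (Nat.zero_le _).trans_lt (hn r hr v hnv)
  · refine le_antisymm (H.view_le (T := T) (v := v) (hmin T (Nat.lt_succ_self T)) (by omega)
      (by omega) j hj) ?_
    exact (hiv.trans (H.le_view_of_delivers hD hD₀ hGT hi hj)).trans
      ((H.replica j hj).le ht).view

end Faithful

end Liveness

end FlexMinBFT

theorem mainTheorem4 {N : ℕ} [NeZero N] {Client Op Res St : Type*}
    (P : FlexMinBFT.Params) (svc : FlexMinBFT.Service Op Res St)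
    (hN : 2 * P.f + 1 ≤ N) (hq : P.f + 1 ≤ P.q) (hq' : P.q + P.f ≤ N)
    (htimeout : Tendsto P.timeout atTop atTop)
    (X : FlexMinBFT.Execution N Client Op Res)
    (R : Finset (Fin N)) (C : Set Client)
    (hR : N ≤ R.card + P.f)
    (hreplica : ∀ i ∈ R, FlexMinBFT.CorrectReplica P svc X i)
    (hclient : ∀ c ∈ C, FlexMinBFT.CorrectClient P.f X c)
    (hauth : FlexMinBFT.Authentic X R C)
    (hsync : FlexMinBFT.PartiallySynchronous X R C) :
    ∀ t m, m.client ∈ C → X.submits t m → ∃ t', FlexMinBFT.Completed P.f X m t' := by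
  intro t m hc hm
  by_contra hno
  have H : FlexMinBFT.Faithful P svc X R C :=
    ⟨hN, hq, hq', hR, hreplica, hauth⟩
  obtain ⟨GST, Δ, hmsg, hrep, hreq⟩ := hsync
  have hD := H.delivers hmsg
  -- A later request of this client would presuppose that `m` completed, and earlier ones have
  -- smaller identifiers.
  have hlast : ∀ m', .request m' ∈ FlexMinBFT.Known X R → m'.client = m.client →
      m.id ≤ m'.id → m' = m := by
    intro m' hm' hcm hid
    obtain ⟨t', ht'⟩ := H.submitted hm' (hcm ▸ hc)
    rcases lt_trichotomy t t' with hlt | rfl | hlt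
    · exact absurd ⟨t', ((hclient _ hc t t' m m' rfl hcm hm ht').2 hlt).2⟩ hno
    · exact ((hclient _ hc t t m m' rfl hcm hm ht').1 rfl).symm
    · have := ((hclient _ hc t' t m' m hcm rfl ht' hm).2 hlt).1
      omega
  have hheld : ∀ i ∈ R, ∃ t, .request m ∈ (X.replica t i).msgs := by
    intro i hi
    obtain ⟨t', -, hx⟩ := hreq t m hc hm i hi
    exact ⟨t' + 1, (hreplica i hi).mem_of_inbox hx⟩
  obtain ⟨t', i, hi, hmi⟩ := H.exists_mem_hist htimeout hD (Nat.succ_pos Δ) hheld hlast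
  refine hno (H.completed hD (Nat.succ_pos Δ) (fun t i hi r id res hx => ?_) hlast hi hmi)
  obtain ⟨t', -, hx⟩ := hrep t i hi r m.client hc id res hx
  exact ⟨t', hx⟩
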